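/- A (rooted) plane tree is a rooted tree in which the children of every vertex are linearly ordered. Label the vertices of a plane tree $T$ as follows: the root has label $0$, and a child $v$ of a vertex labelled $\mu$ has label $\mu+s(v)$, where $s(v)$ is the number of vertices of the maximal subtree rooted at $v$ ($v$ together with all its descendants). The avalanche polynomial of $T$ is $Av_T(q)=\sum_{i\ge 1}p_i q^i$, where $p_i$ is the number of vertices of $T$ with label $i$. For $n\ge 1$ let $A_n(q)=\sum_T Av_T(q)=\sum_m a_{m,n}q^m$, where $T$ runs over all plane trees with $n$ edges (equivalently, $n+1$ vertices). Let $$M_n=\frac{\sum_m m\,a_{m,n}}{\sum_m a_{m,n}},\qquad V_n=\frac{\sum_m (m-M_n)^2\,a_{m,n}}{\sum_m a_{m,n}}$$ be the mean and the variance of the avalanche-size distribution on plane trees with $n$ edges, and let $C_n=\frac1{n+1}\binom{2n}{n}$. Then for every integer $n\ge 1$, $$\begin{aligned}V_n={}&\frac{4}{15}n^3+\frac{73}{60}n^2+\frac{26}{15}n+\frac{8}{15}-\frac{1}{2n}-\frac{1}{4n^2}\\&-\frac{16^{n-1}}{n^2(n+1)^2C_n^2}\left(n^4+6n^3+13n^2+12n+4\right)\\&+\frac{4^{n-1}}{n^2(n+1)C_n}\left(n^3+4n^2+5n+2\right),\end{aligned}$$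 and, as $n\to\infty$, $$V_n\sim\left(\frac{4}{15}-\frac{\pi}{16}\right)n^3 .$$ -/

import Mathlib

/-- Rooted plane trees: a root together with the ordered list of the subtrees hanging from it. -/
inductive PlaneTree : Type where
  | node : List PlaneTree → PlaneTree

namespace PlaneTree

/-- The size of a tree: its number of vertices, the root included. -/
def size : PlaneTree → ℕ
  | node cs => 1 + (cs.map size).sum

/-- The labels of all vertices of a tree (listed with multiplicity) when its root has label `μ`:
a child `c` of a vertex labelled `μ` has label `μ` plus the size of the maximal subtree
rooted at `c`. -/
def labelsFrom : PlaneTree → ℕ → List ℕ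
  | node cs, μ => μ :: cs.flatMap (fun c => labelsFrom c (μ + size c))

/-- The labels of the vertices of a tree, its root being labelled `0`. -/
def labels (T : PlaneTree) : List ℕ := labelsFrom T 0

/-- The avalanche polynomial `∑_{i ≥ 1} p_i q^i`, with `p_i` the number of vertices labelled `i`. -/
noncomputable def avalanche (T : PlaneTree) : Polynomial ℕ :=
  ∑ i ∈ T.labels.toFinset.filter (fun i => 1 ≤ i), Polynomial.monomial i (T.labels.count i)

theorem size_cons (c : PlaneTree) (cs : List PlaneTree) :
    size (node (c :: cs)) = size c + size (node cs) := by
  simp only [size, List.map_cons, List.sum_cons]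
  omega

theorem size_pos (T : PlaneTree) : 0 < size T := by
  cases T
  simp only [size]
  omega

theorem finite_size_le (n : ℕ) : {T : PlaneTree | size T ≤ n}.Finite := by
  induction n with
  | zero =>
    refine Set.finite_empty.subset fun T hT => ?_
    have := size_pos T
    simp only [Set.mem_ofPred_eq] at hT
    omega
  | succ n ih =>
    refine (((ih.prod ih).image
      (fun p : PlaneTree × PlaneTree => match p.2 with
        | node cs => node (p.1 :: cs))).union (Set.finite_singleton (node []))).subset ?_
    rintro ⟨_ | ⟨c, cs⟩⟩ hT
    · exact Or.inr rfl
    · refine Or.inl ⟨(c, node cs), ⟨?_, ?_⟩, rfl⟩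
      all_goals
        simp only [Set.mem_ofPred_eq, size_cons] at hT ⊢
        have h1 := size_pos c
        have h2 := size_pos (node cs)
        omega

/-- The finite set of plane trees with `n` edges, that is, with `n + 1` vertices. -/
noncomputable def withEdges (n : ℕ) : Finset PlaneTree :=
  Set.Finite.toFinset (s := {T : PlaneTree | size T = n + 1})
    ((finite_size_le (n + 1)).subset fun _ hT => le_of_eq hT)

/-- `A_n(q)`, the sum of the avalanche polynomials of all plane trees with `n` edges. -/
noncomputable def totalAvalanche (n : ℕ) : Polynomial ℕ :=
  ∑ T ∈ withEdges n, avalanche T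

/-- The total number `∑_m a_m` of avalanches, where `A_n(q) = ∑_m a_m q^m`. -/
noncomputable def avalancheCount (n : ℕ) : ℝ :=
  (totalAvalanche n).sum fun _ a => (a : ℝ)

/-- The mean `M_n = (∑_m m a_m) / (∑_m a_m)` of the avalanche-size distribution. -/
noncomputable def avalancheMean (n : ℕ) : ℝ :=
  ((totalAvalanche n).sum fun m a => (m : ℝ) * (a : ℝ)) / avalancheCount n

/-- The variance `V_n = (∑_m (m - M_n)² a_m) / (∑_m a_m)` of the avalanche-size distribution. -/
noncomputable def avalancheVariance (n : ℕ) : ℝ :=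
  ((totalAvalanche n).sum fun m a => ((m : ℝ) - avalancheMean n) ^ 2 * (a : ℝ)) /
    avalancheCount n

end PlaneTree

/-!
Removing the leftmost subtree `c` of the root of a nonempty tree leaves a tree `T`, and the labels
of the whole tree are those of `T` together with those of `c`, all shifted by the size of `c`. Hence
the sums of the labels and of their squares, taken over all trees with `n` edges, satisfy linear
convolution recursions against the Catalan numbers (`labelMoment_one_succ`, `labelMoment_two_succ`),
and the mean and the variance are expressed by these two sums, because the root is the only vertex
labelled `0` and every tree therefore contributes `n` avalanches (`avalancheVariance_eq`).

For the generating functions the recursions are linear equations in which the unknown is multiplied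
by `s = √(1 - 4 X) = 1 - 2 X c(X)`, with `c` the Catalan series. The inverse of `s` is the series
`u = ∑ centralBinom n X ^ n` (`sqrt_mul_centralGF`), and `u' = 2 u ^ 3`, so that every series
involved is a polynomial in `u`: the series of the sums of labels is
`(u ^ 4 - u ^ 3 + u ^ 2 - u) / 4`, that of the sums of squares is `(u ^ 7 - u ^ 6) / 2`. The
coefficients of `u ^ (k + 2)` come from those of `u ^ k` by differentiation, which gives the
variance in closed form. In its asymptotics, the term with `16 ^ (n - 1)` is governed by Wallis'
product, since `16 ^ n / centralBinom n ^ 2 = (2 n + 1) W n`, and contributes `-π / 16`.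
-/

open Finset

namespace PlaneTree

/-! ### The decomposition of a plane tree at its first subtree -/

theorem size_node_nil : size (node []) = 1 := by
  simp [size]

/-- Every plane tree is either a single vertex or arises from a tree `node cs` by grafting a tree
`c` as a new leftmost subtree of the root. -/
theorem cons_induction {P : PlaneTree → Prop} (nil : P (node []))
    (cons : ∀ c cs, P c → P (node cs) → P (node (c :: cs))) (T : PlaneTree) : P T := by
  induction h : size T using Nat.strong_induction_on generalizing T with
  | _ n ih =>
    subst h
    rcases T with ⟨_ | ⟨c, cs⟩⟩
    · exact nil
    · have hs := size_cons c cs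
      have h1 := size_pos c
      have h2 := size_pos (node cs)
      exact cons c cs (ih _ (by omega) _ rfl) (ih _ (by omega) _ rfl)

theorem mem_withEdges {n : ℕ} {T : PlaneTree} : T ∈ withEdges n ↔ size T = n + 1 := by
  simp [withEdges]

theorem withEdges_zero : withEdges 0 = {node []} := by
  ext ⟨_ | ⟨c, cs⟩⟩
  · simp [mem_withEdges, size_node_nil]
  · have h1 := size_pos c
    have h2 := size_pos (node cs)
    simp only [mem_withEdges, size_cons, mem_singleton, node.injEq, reduceCtorEq, iff_false]
    omega

theorem sum_withEdges_zero {M : Type*} [AddCommMonoid M] (f : PlaneTree → M) :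
    ∑ T ∈ withEdges 0, f T = f (node []) := by
  rw [withEdges_zero, sum_singleton]

/-- Grafts `c` onto the root of `T` as its new leftmost subtree. -/
def graft (c : PlaneTree) : PlaneTree → PlaneTree
  | node cs => node (c :: cs)

theorem size_graft (c T : PlaneTree) : size (graft c T) = size c + size T := by
  cases T
  exact size_cons _ _

theorem graft_inj {c T c' T' : PlaneTree} : graft c T = graft c' T' ↔ c = c' ∧ T = T' := by
  cases T
  cases T'
  simp [graft]

/-- The first-subtree decomposition: a sum over the trees with `n + 1` edges is a convolution. -/
theorem sum_withEdges_succ {M : Type*} [AddCommMonoid M] (f : PlaneTree → M) (n : ℕ) :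
    ∑ T ∈ withEdges (n + 1), f T =
      ∑ p ∈ antidiagonal n, ∑ c ∈ withEdges p.1, ∑ T ∈ withEdges p.2, f (graft c T) := by
  simp_rw [← sum_product']
  rw [sum_sigma']
  symm
  refine sum_bij (fun x _ => graft x.2.1 x.2.2) ?_ ?_ ?_ ?_
  · rintro ⟨⟨i, j⟩, c, T⟩ h
    simp only [mem_sigma, HasAntidiagonal.mem_antidiagonal, mem_product, mem_withEdges] at h
    simp only [mem_withEdges, size_graft]
    omega
  · rintro ⟨⟨i, j⟩, c, T⟩ h ⟨⟨i', j'⟩, c', T'⟩ h' heq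
    simp only [mem_sigma, HasAntidiagonal.mem_antidiagonal, mem_product, mem_withEdges] at h h'
    replace heq : c = c' ∧ T = T' := graft_inj.1 heq
    obtain ⟨rfl, rfl⟩ := heq
    obtain rfl : i = i' := by omega
    obtain rfl : j = j' := by omega
    rfl
  · rintro ⟨_ | ⟨c, cs⟩⟩ h
    · simp [mem_withEdges, size_node_nil] at h
    · have h1 := size_pos c
      have h2 := size_pos (node cs)
      rw [mem_withEdges, size_cons] at h
      refine ⟨⟨(size c - 1, size (node cs) - 1), c, node cs⟩, ?_, rfl⟩
      simp only [mem_sigma, HasAntidiagonal.mem_antidiagonal, mem_product, mem_withEdges]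
      omega
  · intros
    rfl

theorem card_withEdges (n : ℕ) : #(withEdges n) = catalan n := by
  induction n using Nat.strong_induction_on with
  | _ n ih =>
    cases n with
    | zero => simp [withEdges_zero]
    | succ n =>
      rw [card_eq_sum_ones, sum_withEdges_succ, catalan_succ']
      refine sum_congr rfl fun p hp => ?_
      have h := HasAntidiagonal.mem_antidiagonal.1 hp
      simp [ih p.1 (by omega), ih p.2 (by omega)]

/-! ### Power sums of labels -/

/-- The sum of `l ^ k` over the labels `l` of all vertices of `T`, the root being labelled `μ`. -/
noncomputable def labelPowerSum (k : ℕ) (T : PlaneTree) (μ : ℕ) : ℝ :=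
  ((labelsFrom T μ).map fun l : ℕ => (l : ℝ) ^ k).sum

theorem labelPowerSum_nil (k μ : ℕ) : labelPowerSum k (node []) μ = (μ : ℝ) ^ k := by
  simp [labelPowerSum, labelsFrom]

theorem labelPowerSum_cons (k : ℕ) (c : PlaneTree) (cs : List PlaneTree) (μ : ℕ) :
    labelPowerSum k (node (c :: cs)) μ =
      labelPowerSum k c (μ + size c) + labelPowerSum k (node cs) μ := by
  simp only [labelPowerSum, labelsFrom, List.flatMap_cons, List.map_cons, List.map_append,
    List.sum_cons, List.sum_append]
  ring

theorem labelPowerSum_graft (k : ℕ) (c T : PlaneTree) (μ : ℕ) :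
    labelPowerSum k (graft c T) μ =
      labelPowerSum k c (μ + size c) + labelPowerSum k T μ := by
  cases T
  exact labelPowerSum_cons _ _ _ _

theorem labelPowerSum_zero_left (T : PlaneTree) (μ : ℕ) : labelPowerSum 0 T μ = size T := by
  induction T using cons_induction generalizing μ with
  | nil => simp [labelPowerSum_nil, size_node_nil]
  | cons c cs h1 h2 => rw [labelPowerSum_cons, h1, h2, size_cons, Nat.cast_add]

theorem labelPowerSum_one_left (T : PlaneTree) (μ : ℕ) :
    labelPowerSum 1 T μ = labelPowerSum 1 T 0 + μ * size T := by
  induction T using cons_induction generalizing μ with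
  | nil => simp [labelPowerSum_nil, size_node_nil]
  | cons c cs h1 h2 =>
    rw [labelPowerSum_cons, labelPowerSum_cons, h1, h1 (0 + _), h2, size_cons]
    push_cast
    ring

theorem labelPowerSum_two_left (T : PlaneTree) (μ : ℕ) :
    labelPowerSum 2 T μ =
      labelPowerSum 2 T 0 + 2 * μ * labelPowerSum 1 T 0 + μ ^ 2 * size T := by
  induction T using cons_induction generalizing μ with
  | nil => simp [labelPowerSum_nil, size_node_nil]
  | cons c cs h1 h2 =>
    rw [labelPowerSum_cons, labelPowerSum_cons, labelPowerSum_cons, h1, h1 (0 + _), h2,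
      labelPowerSum_one_left c (0 + _), size_cons]
    push_cast
    ring

/-- The root is the only vertex labelled `0`. -/
theorem labels_eq_zero_cons (T : PlaneTree) :
    ∃ t : List ℕ, T.labels = 0 :: t ∧ ∀ l ∈ t, 1 ≤ l := by
  have le_of_mem (T : PlaneTree) : ∀ μ, ∀ l ∈ labelsFrom T μ, μ ≤ l := by
    induction T using cons_induction with
    | nil => simp [labelsFrom]
    | cons c cs h1 h2 =>
      intro μ l hl
      simp only [labelsFrom, List.flatMap_cons, List.mem_cons, List.mem_append] at hl h2
      rcases hl with h | h | h
      · exact h.ge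
      · exact (Nat.le_add_right _ _).trans (h1 _ _ h)
      · exact h2 _ _ (Or.inr h)
  obtain ⟨cs⟩ := T
  refine ⟨_, by rw [labels, labelsFrom], fun l hl => ?_⟩
  obtain ⟨c, -, hc⟩ := List.mem_flatMap.1 hl
  have h1 := le_of_mem c _ l hc
  have h2 := size_pos c
  omega

/-! ### Moments of the avalanche-size distribution -/

/-- Weighting the coefficients of the avalanche polynomial by `m ^ k` sums `l ^ k` over all labels
except that of the root, whose contribution `0 ^ k` matters only for `k = 0`. -/
theorem avalanche_sum (T : PlaneTree) (k : ℕ) :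
    (avalanche T).sum (fun m a => (m : ℝ) ^ k * (a : ℝ)) = labelPowerSum k T 0 - 0 ^ k := by
  have lin (s : Finset ℕ) (a : ℕ → ℕ) :
      (∑ i ∈ s, Polynomial.monomial i (a i)).sum (fun m a => (m : ℝ) ^ k * (a : ℝ)) =
        ∑ i ∈ s, (i : ℝ) ^ k * (a i : ℝ) := by
    induction s using Finset.induction_on with
    | empty => simp
    | insert i s hi ih =>
      rw [sum_insert hi, sum_insert hi, Polynomial.sum_add_index _ _ _ (by simp)
        (by intros; push_cast; ring), ih, Polynomial.sum_monomial_index _ _ (by simp)]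
  rw [avalanche, lin, sum_filter]
  have h := sum_list_map_count T.labels (fun l : ℕ => if 1 ≤ l then (l : ℝ) ^ k else 0)
  obtain ⟨t, ht, hpos⟩ := labels_eq_zero_cons T
  have h2 : labelPowerSum k T 0 = (T.labels.map fun l : ℕ => (l : ℝ) ^ k).sum := rfl
  rw [h2]
  calc _ = (T.labels.map fun l : ℕ => if 1 ≤ l then (l : ℝ) ^ k else 0).sum := by
        rw [h]
        refine sum_congr rfl fun i _ => ?_
        split_ifs <;> simp [mul_comm]
    _ = _ := by
        rw [ht, List.map_cons, List.map_cons, List.sum_cons, List.sum_cons,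
          List.map_congr_left (g := fun l : ℕ => (l : ℝ) ^ k) fun l hl => if_pos (hpos l hl)]
        simp

theorem totalAvalanche_sum (n k : ℕ) :
    (totalAvalanche n).sum (fun m a => (m : ℝ) ^ k * (a : ℝ)) =
      ∑ T ∈ withEdges n, (labelPowerSum k T 0 - 0 ^ k) := by
  classical
  rw [totalAvalanche]
  induction withEdges n using Finset.induction_on with
  | empty => simp
  | insert T s hT ih =>
    rw [sum_insert hT, sum_insert hT, Polynomial.sum_add_index _ _ _ (by simp)
      (by intros; push_cast; ring), ih, avalanche_sum]

/-- The sum of the `k`-th powers of all labels over all plane trees with `n` edges. -/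
noncomputable def labelMoment (k n : ℕ) : ℝ :=
  ∑ T ∈ withEdges n, labelPowerSum k T 0

theorem avalancheCount_eq (n : ℕ) : avalancheCount n = n * catalan n := by
  have h := totalAvalanche_sum n 0
  simp only [pow_zero, one_mul, labelPowerSum_zero_left] at h
  rw [avalancheCount, h, sum_congr rfl (g := fun _ => (n : ℝ)), sum_const, card_withEdges,
    nsmul_eq_mul, mul_comm]
  intro T hT
  rw [mem_withEdges.1 hT]
  push_cast
  ring

theorem avalancheMean_eq (n : ℕ) : avalancheMean n = labelMoment 1 n / (n * catalan n) := by
  have h := totalAvalanche_sum n 1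
  simp only [pow_one, sub_zero] at h
  rw [avalancheMean, avalancheCount_eq, h, labelMoment]

theorem catalan_pos (n : ℕ) : 0 < catalan n :=
  Nat.pos_of_mul_pos_left (a := n + 1) (by
    rw [succ_mul_catalan_eq_centralBinom]
    exact n.centralBinom_pos)

theorem avalancheVariance_eq {n : ℕ} (hn : 1 ≤ n) :
    avalancheVariance n = labelMoment 2 n / (n * catalan n) -
      (labelMoment 1 n / (n * catalan n)) ^ 2 := by
  have h0 := totalAvalanche_sum n 0
  have h1 := totalAvalanche_sum n 1
  have h2 := totalAvalanche_sum n 2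
  have hc := avalancheCount_eq n
  simp only [pow_zero, one_mul] at h0
  rw [avalancheCount] at hc
  have hexp : (totalAvalanche n).sum
        (fun m a => ((m : ℝ) - avalancheMean n) ^ 2 * (a : ℝ)) =
      (totalAvalanche n).sum (fun m a => (m : ℝ) ^ 2 * (a : ℝ)) -
        2 * avalancheMean n * (totalAvalanche n).sum (fun m a => (m : ℝ) ^ 1 * (a : ℝ)) +
        avalancheMean n ^ 2 * (totalAvalanche n).sum (fun _ a => (a : ℝ)) := by
    simp only [Polynomial.sum_def, mul_sum, ← sum_sub_distrib, ← sum_add_distrib]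
    exact sum_congr rfl fun i _ => by ring
  have hn' : (n : ℝ) ≠ 0 := by positivity
  have hC : (catalan n : ℝ) ≠ 0 := by exact_mod_cast (catalan_pos n).ne'
  rw [avalancheVariance, hexp, hc, h1, h2, avalancheCount_eq, avalancheMean_eq]
  simp only [ne_eq, OfNat.ofNat_ne_zero, one_ne_zero, not_false_eq_true, zero_pow, sub_zero]
  change (labelMoment 2 n - 2 * _ * labelMoment 1 n + _) / _ = _
  field_simp
  ring

theorem labelMoment_zero_right {k : ℕ} (hk : k ≠ 0) : labelMoment k 0 = 0 := by
  simp [labelMoment, sum_withEdges_zero, labelPowerSum_nil, hk]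

theorem labelMoment_one_succ (n : ℕ) :
    labelMoment 1 (n + 1) = ∑ p ∈ antidiagonal n,
      (labelMoment 1 p.1 * catalan p.2 + catalan p.1 * labelMoment 1 p.2 +
        (((p.1 : ℝ) + 1) ^ 2 * catalan p.1) * catalan p.2) := by
  rw [labelMoment, sum_withEdges_succ]
  refine sum_congr rfl fun p _ => ?_
  have h (c) (hc : c ∈ withEdges p.1) : ∑ T ∈ withEdges p.2, labelPowerSum 1 (graft c T) 0 =
      catalan p.2 * labelPowerSum 1 c 0 +
        (catalan p.2 * ((p.1 : ℝ) + 1) ^ 2 + labelMoment 1 p.2) := by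
    simp only [labelPowerSum_graft, labelPowerSum_one_left c (0 + _), sum_add_distrib,
      sum_const, card_withEdges, nsmul_eq_mul, mem_withEdges.1 hc, labelMoment]
    push_cast
    ring
  rw [sum_congr rfl h, sum_add_distrib, sum_const, card_withEdges, ← mul_sum, nsmul_eq_mul,
    labelMoment, labelMoment]
  ring

theorem labelMoment_two_succ (n : ℕ) :
    labelMoment 2 (n + 1) = ∑ p ∈ antidiagonal n,
      (labelMoment 2 p.1 * catalan p.2 + catalan p.1 * labelMoment 2 p.2 +
        2 * ((((p.1 : ℝ) + 1) * labelMoment 1 p.1) * catalan p.2) +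
        (((p.1 : ℝ) + 1) ^ 3 * catalan p.1) * catalan p.2) := by
  rw [labelMoment, sum_withEdges_succ]
  refine sum_congr rfl fun p _ => ?_
  have h (c) (hc : c ∈ withEdges p.1) : ∑ T ∈ withEdges p.2, labelPowerSum 2 (graft c T) 0 =
      catalan p.2 * labelPowerSum 2 c 0 +
        catalan p.2 * (2 * ((p.1 : ℝ) + 1)) * labelPowerSum 1 c 0 +
        (catalan p.2 * ((p.1 : ℝ) + 1) ^ 3 + labelMoment 2 p.2) := by
    simp only [labelPowerSum_graft, labelPowerSum_two_left c (0 + _), sum_add_distrib,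
      sum_const, card_withEdges, nsmul_eq_mul, mem_withEdges.1 hc, labelMoment]
    push_cast
    ring
  rw [sum_congr rfl h, sum_add_distrib, sum_add_distrib, sum_const, card_withEdges, ← mul_sum,
    ← mul_sum, nsmul_eq_mul, labelMoment, labelMoment, labelMoment]
  ring

end PlaneTree

/-! ### The generating function of the central binomial coefficients -/

namespace CentralBinomSeries

open PowerSeries

/-- The generating function of the Catalan numbers, over `ℝ`. -/
noncomputable def catalanGF : ℝ⟦X⟧ := PowerSeries.mk fun n => (catalan n : ℝ)

/-- The generating function of the central binomial coefficients, over `ℝ`. -/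
noncomputable def centralGF : ℝ⟦X⟧ := PowerSeries.mk fun n => (n.centralBinom : ℝ)

/-- The operator multiplying the `n`-th coefficient by `n + 1`. -/
noncomputable def weight (f : ℝ⟦X⟧) : ℝ⟦X⟧ := d⁄dX ℝ (X * f)

theorem coeff_weight (f : ℝ⟦X⟧) (n : ℕ) : coeff n (weight f) = ((n : ℝ) + 1) * coeff n f := by
  rw [weight, coeff_derivative, coeff_succ_X_mul, mul_comm]

theorem weight_eq (f : ℝ⟦X⟧) : weight f = f + X * d⁄dX ℝ f := by
  rw [weight, Derivation.leibniz, derivative_X]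
  simp only [smul_eq_mul]
  ring

theorem catalanGF_eq : catalanGF = 1 + X * catalanGF ^ 2 := by
  ext n
  cases n with
  | zero => simp [catalanGF]
  | succ n =>
    rw [map_add, coeff_one, if_neg n.succ_ne_zero, zero_add, coeff_succ_X_mul, sq, coeff_mul]
    simp [catalanGF, catalan_succ']

theorem weight_catalanGF : weight catalanGF = centralGF := by
  ext n
  rw [coeff_weight, catalanGF, centralGF, coeff_mk, coeff_mk,
    ← succ_mul_catalan_eq_centralBinom]
  push_cast
  ring

/-- `1 - 2 X c` is the square root of `1 - 4 X`, with `c` the Catalan generating function. -/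
theorem sqrt_sq : (1 - 2 * X * catalanGF) ^ 2 = 1 - 4 * X := by
  linear_combination (-4 * X) * catalanGF_eq

theorem coeff_natCast_mul (k n : ℕ) (f : ℝ⟦X⟧) : coeff n ((k : ℝ⟦X⟧) * f) = k * coeff n f := by
  rw [← map_natCast (C (R := ℝ)), coeff_C_mul]

theorem derivative_natCast_mul (k : ℕ) (f : ℝ⟦X⟧) : d⁄dX ℝ (k * f) = k * d⁄dX ℝ f := by
  rw [Derivation.leibniz, Derivation.map_natCast, smul_zero, add_zero, smul_eq_mul]

theorem derivative_sqrt : d⁄dX ℝ (1 - 2 * X * catalanGF) = -2 * centralGF := by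
  have h := derivative_natCast_mul 2 (X * catalanGF)
  rw [← weight, weight_catalanGF, Nat.cast_ofNat, ← mul_assoc] at h
  rw [map_sub, h, derivative_one]
  ring

/-- Differentiating `(1 - 2 X c) ^ 2 = 1 - 4 X` shows that the central binomial generating function
is the inverse of `√(1 - 4 X) = 1 - 2 X c`. -/
theorem sqrt_mul_centralGF : (1 - 2 * X * catalanGF) * centralGF = 1 := by
  have h := congrArg (d⁄dX ℝ) sqrt_sq
  have h4 := derivative_natCast_mul 4 X
  rw [derivative_X, Nat.cast_ofNat] at h4
  rw [Derivation.leibniz_pow, derivative_sqrt, map_sub, derivative_one, h4] at h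
  have h5 : (-4 : ℝ⟦X⟧) ≠ 0 := by
    rw [neg_ne_zero]
    exact_mod_cast (map_ne_zero_iff (C (R := ℝ)) C_injective).2 (by norm_num : (4 : ℝ) ≠ 0)
  refine mul_left_cancel₀ h5 ?_
  simp only [smul_eq_mul, nsmul_eq_mul] at h
  push_cast at h
  linear_combination h

theorem derivative_centralGF : d⁄dX ℝ centralGF = 2 * centralGF ^ 3 := by
  have h := congrArg (d⁄dX ℝ) sqrt_mul_centralGF
  rw [Derivation.leibniz, derivative_sqrt, derivative_one] at h
  simp only [smul_eq_mul] at h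
  linear_combination centralGF * h - (d⁄dX ℝ centralGF) * sqrt_mul_centralGF

theorem derivative_centralGF_pow (k : ℕ) :
    d⁄dX ℝ (centralGF ^ k) = 2 * k * centralGF ^ (k + 2) := by
  rw [Derivation.leibniz_pow, derivative_centralGF]
  cases k with
  | zero => simp
  | succ k =>
    simp only [smul_eq_mul, nsmul_eq_mul, Nat.add_sub_cancel]
    ring

theorem four_X_mul_centralGF_sq : 4 * X * centralGF ^ 2 = centralGF ^ 2 - 1 := by
  linear_combination centralGF ^ 2 * sqrt_sq - (((1 - 2 * X * catalanGF) * centralGF) + 1) *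
    sqrt_mul_centralGF

/-! ### Coefficients of the powers of the central binomial series -/

theorem coeff_centralGF_pow_add_two (k n : ℕ) :
    2 * k * coeff n (centralGF ^ (k + 2)) = ((n : ℝ) + 1) * coeff (n + 1) (centralGF ^ k) := by
  have h := congrArg (coeff n) (derivative_centralGF_pow k)
  have h2 : (2 * k * centralGF ^ (k + 2) : ℝ⟦X⟧) = ((2 * k : ℕ) : ℝ⟦X⟧) * centralGF ^ (k + 2) := by
    push_cast
    rfl
  rw [coeff_derivative, h2, coeff_natCast_mul] at h
  push_cast at h
  linarith

theorem coeff_centralGF (n : ℕ) : coeff n centralGF = (n.centralBinom : ℝ) := by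
  simp [centralGF]

theorem centralBinom_succ_cast (n : ℕ) :
    ((n : ℝ) + 1) * (n + 1).centralBinom = 2 * (2 * n + 1) * n.centralBinom := by
  exact_mod_cast Nat.succ_mul_centralBinom_succ n

theorem coeff_centralGF_pow_two (n : ℕ) : coeff n (centralGF ^ 2) = 4 ^ n := by
  induction n with
  | zero => simp [centralGF]
  | succ n ih =>
    have h := congrArg (coeff (n + 1)) four_X_mul_centralGF_sq
    have h4 := coeff_natCast_mul 4 (n + 1) (X * centralGF ^ 2)
    rw [coeff_succ_X_mul, ih, Nat.cast_ofNat, ← mul_assoc, h] at h4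
    rw [map_sub, coeff_one, if_neg n.succ_ne_zero, sub_zero] at h4
    rw [h4]
    push_cast
    ring

theorem coeff_centralGF_pow_three (n : ℕ) :
    coeff n (centralGF ^ 3) = (2 * (n : ℝ) + 1) * n.centralBinom := by
  have h := coeff_centralGF_pow_add_two 1 n
  rw [pow_one, coeff_centralGF, centralBinom_succ_cast] at h
  push_cast at h
  linarith

theorem coeff_centralGF_pow_four (n : ℕ) : coeff n (centralGF ^ 4) = ((n : ℝ) + 1) * 4 ^ n := by
  have h := coeff_centralGF_pow_add_two 2 n
  rw [coeff_centralGF_pow_two, pow_succ (4 : ℝ)] at h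
  push_cast at h
  linarith

theorem coeff_centralGF_pow_five (n : ℕ) :
    coeff n (centralGF ^ 5) = (2 * (n : ℝ) + 1) * (2 * n + 3) / 3 * n.centralBinom := by
  have h := coeff_centralGF_pow_add_two 3 n
  rw [coeff_centralGF_pow_three] at h
  push_cast at h
  linear_combination h / 6 + (2 * n + 3) / 6 * centralBinom_succ_cast n

theorem coeff_centralGF_pow_six (n : ℕ) :
    coeff n (centralGF ^ 6) = ((n : ℝ) + 1) * (n + 2) / 2 * 4 ^ n := by
  have h := coeff_centralGF_pow_add_two 4 n
  rw [coeff_centralGF_pow_four, pow_succ (4 : ℝ)] at h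
  push_cast at h
  linarith

theorem coeff_centralGF_pow_seven (n : ℕ) :
    coeff n (centralGF ^ 7) =
      (2 * (n : ℝ) + 1) * (2 * n + 3) * (2 * n + 5) / 15 * n.centralBinom := by
  have h := coeff_centralGF_pow_add_two 5 n
  rw [coeff_centralGF_pow_five] at h
  push_cast at h
  linear_combination h / 10 + (2 * n + 3) * (2 * n + 5) / 30 * centralBinom_succ_cast n

end CentralBinomSeries

namespace PlaneTree

open PowerSeries CentralBinomSeries

/-! ### The generating functions of the label moments -/

/-- The generating function of the `k`-th label moments. -/
noncomputable def labelMomentGF (k : ℕ) : ℝ⟦X⟧ := PowerSeries.mk (labelMoment k)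

theorem labelMomentGF_one_eq :
    labelMomentGF 1 = X * (2 * (catalanGF * labelMomentGF 1) +
      weight (weight catalanGF) * catalanGF) := by
  ext n
  cases n with
  | zero => simp [labelMomentGF, labelMoment_zero_right]
  | succ n =>
    have h (f : ℝ⟦X⟧) : 2 * (catalanGF * f) = f * catalanGF + catalanGF * f := by ring
    rw [coeff_succ_X_mul, h, map_add, map_add, coeff_mul, coeff_mul, coeff_mul,
      ← sum_add_distrib, ← sum_add_distrib]
    simp only [coeff_weight, labelMomentGF, catalanGF, coeff_mk, labelMoment_one_succ]
    exact sum_congr rfl fun p _ => by ring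

theorem labelMomentGF_two_eq :
    labelMomentGF 2 = X * (2 * (catalanGF * labelMomentGF 2) +
      2 * (weight (labelMomentGF 1) * catalanGF) +
      weight (weight (weight catalanGF)) * catalanGF) := by
  ext n
  cases n with
  | zero => simp [labelMomentGF, labelMoment_zero_right]
  | succ n =>
    have h (f g : ℝ⟦X⟧) : 2 * (catalanGF * f) + 2 * g = f * catalanGF + catalanGF * f + g + g := by
      ring
    rw [coeff_succ_X_mul, h]
    simp only [map_add, coeff_mul, ← sum_add_distrib]
    simp only [coeff_weight, labelMomentGF, catalanGF, coeff_mk, labelMoment_two_succ]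
    exact sum_congr rfl fun p _ => by ring

theorem two_mul_weight_centralGF : 2 * weight centralGF = centralGF + centralGF ^ 3 := by
  rw [weight_eq, derivative_centralGF]
  linear_combination centralGF * four_X_mul_centralGF_sq

theorem four_mul_weight_weight_centralGF :
    4 * weight (weight centralGF) = centralGF + 3 * centralGF ^ 5 := by
  have h := congrArg (d⁄dX ℝ) two_mul_weight_centralGF
  have h2 := derivative_natCast_mul 2 (weight centralGF)
  rw [Nat.cast_ofNat] at h2
  rw [h2, map_add, derivative_centralGF, derivative_centralGF_pow] at h
  push_cast at h
  rw [weight_eq (weight centralGF)]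
  linear_combination 2 * two_mul_weight_centralGF + 2 * X * h +
    (centralGF + 3 * centralGF ^ 3) * four_X_mul_centralGF_sq

/-- The recursion reads `(1 - 2 X c) A = X c (c weighted twice)`; multiplying by the inverse
`centralGF` of `1 - 2 X c` turns it into a closed form for `A`. -/
theorem four_mul_labelMomentGF_one :
    4 * labelMomentGF 1 = centralGF ^ 2 + centralGF ^ 4 - centralGF ^ 1 - centralGF ^ 3 := by
  have h := labelMomentGF_one_eq
  rw [weight_catalanGF] at h
  have h2 : 2 * labelMomentGF 1 = (centralGF - 1) * weight centralGF := by
    linear_combination 2 * centralGF * h +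
      (-2 * labelMomentGF 1 - weight centralGF) * sqrt_mul_centralGF
  linear_combination 2 * h2 + (centralGF - 1) * two_mul_weight_centralGF

theorem sixteen_mul_labelMomentGF_two :
    16 * labelMomentGF 2 = 8 * (centralGF ^ 7 - centralGF ^ 6) := by
  have h := labelMomentGF_two_eq
  rw [weight_catalanGF] at h
  have h2 : 2 * labelMomentGF 2 =
      (centralGF - 1) * (2 * weight (labelMomentGF 1) + weight (weight centralGF)) := by
    linear_combination 2 * centralGF * h +
      (-2 * labelMomentGF 2 - (2 * weight (labelMomentGF 1) + weight (weight centralGF))) *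
        sqrt_mul_centralGF
  have hd := congrArg (d⁄dX ℝ) four_mul_labelMomentGF_one
  have h4 := derivative_natCast_mul 4 (labelMomentGF 1)
  rw [Nat.cast_ofNat] at h4
  simp only [h4, map_add, map_sub, derivative_centralGF_pow] at hd
  push_cast at hd
  rw [weight_eq (labelMomentGF 1)] at h2
  linear_combination 8 * h2 + (centralGF - 1) * (4 * four_mul_labelMomentGF_one + 4 * X * hd +
    2 * four_mul_weight_weight_centralGF + (4 * centralGF ^ 2 + 8 * centralGF ^ 4 -
      2 * centralGF - 6 * centralGF ^ 3) * four_X_mul_centralGF_sq)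

theorem labelMoment_one_eq (n : ℕ) :
    labelMoment 1 n = ((n + 2) * 4 ^ n - 2 * (n + 1) * n.centralBinom) / 4 := by
  have h := congrArg (coeff n) four_mul_labelMomentGF_one
  have h4 := coeff_natCast_mul 4 n (labelMomentGF 1)
  rw [Nat.cast_ofNat] at h4
  rw [h4, map_sub, map_sub, map_add, coeff_centralGF_pow_two, coeff_centralGF_pow_four,
    pow_one, coeff_centralGF, coeff_centralGF_pow_three, labelMomentGF, coeff_mk] at h
  push_cast at h
  linarith

theorem labelMoment_two_eq (n : ℕ) :
    labelMoment 2 n = ((2 * n + 1) * (2 * n + 3) * (2 * n + 5) / 15 * n.centralBinom -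
      (n + 1) * (n + 2) / 2 * 4 ^ n) / 2 := by
  have h := congrArg (coeff n) sixteen_mul_labelMomentGF_two
  have h4 := coeff_natCast_mul 16 n (labelMomentGF 2)
  have h8 := coeff_natCast_mul 8 n (centralGF ^ 7 - centralGF ^ 6)
  rw [Nat.cast_ofNat] at h4 h8
  rw [h4, h8, map_sub, coeff_centralGF_pow_seven, coeff_centralGF_pow_six, labelMomentGF,
    coeff_mk] at h
  push_cast at h
  linarith

/-! ### The variance in closed form -/

theorem avalancheVariance_closed_form {n : ℕ} (hn : 1 ≤ n) :
    avalancheVariance n =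
        4 / 15 * (n : ℝ) ^ 3 + 73 / 60 * (n : ℝ) ^ 2 + 26 / 15 * (n : ℝ) + 8 / 15
          - 1 / (2 * (n : ℝ)) - 1 / (4 * (n : ℝ) ^ 2)
          - (16 : ℝ) ^ (n - 1) / ((n : ℝ) ^ 2 * ((n : ℝ) + 1) ^ 2 * (catalan n : ℝ) ^ 2)
              * ((n : ℝ) ^ 4 + 6 * (n : ℝ) ^ 3 + 13 * (n : ℝ) ^ 2 + 12 * (n : ℝ) + 4)
          + (4 : ℝ) ^ (n - 1) / ((n : ℝ) ^ 2 * ((n : ℝ) + 1) * (catalan n : ℝ))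
              * ((n : ℝ) ^ 3 + 4 * (n : ℝ) ^ 2 + 5 * (n : ℝ) + 2) := by
  have hcb : (n.centralBinom : ℝ) = (n + 1) * catalan n := by
    exact_mod_cast (succ_mul_catalan_eq_centralBinom n).symm
  have hn0 : (n : ℝ) ≠ 0 := by positivity
  have hn1 : (n : ℝ) + 1 ≠ 0 := by positivity
  have hC : (catalan n : ℝ) ≠ 0 := by exact_mod_cast (catalan_pos n).ne'
  have h4 : (4 : ℝ) ^ n = 4 * 4 ^ (n - 1) := by rw [← pow_succ', Nat.sub_add_cancel hn]
  have h16 : (16 : ℝ) ^ (n - 1) = (4 ^ (n - 1)) ^ 2 := by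
    rw [← pow_mul, mul_comm, pow_mul]
    norm_num
  rw [avalancheVariance_eq hn, labelMoment_one_eq, labelMoment_two_eq, hcb, h4, h16]
  generalize (4 : ℝ) ^ (n - 1) = P
  generalize (catalan n : ℝ) = K at *
  generalize (n : ℝ) = x at *
  field_simp
  ring

/-! ### Asymptotics -/

open Filter Topology Real

/-- Wallis' product in terms of the central binomial coefficient. -/
theorem wallis_mul_centralBinom_sq (n : ℕ) :
    Wallis.W n * (2 * n + 1) * (n.centralBinom : ℝ) ^ 2 = 16 ^ n := by
  induction n with
  | zero => simp [Wallis.W]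
  | succ n ih =>
    have h := centralBinom_succ_cast n
    have h1 : (n : ℝ) + 1 ≠ 0 := by positivity
    have h2 : ((n + 1).centralBinom : ℝ) = 2 * (2 * n + 1) * n.centralBinom / (n + 1) := by
      rw [← h]
      field_simp
    rw [h2, Wallis.W_succ, pow_succ (16 : ℝ), ← ih]
    push_cast
    have h3 : (2 * n + 1 : ℝ) ≠ 0 := by positivity
    have h4 : (2 * n + 3 : ℝ) ≠ 0 := by positivity
    field_simp
    ring

theorem tendsto_avalancheVariance_div_pow_three :
    Tendsto (fun n : ℕ => avalancheVariance n / (n : ℝ) ^ 3) atTop (𝓝 (4 / 15 - π / 16)) := by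
  have hi : Tendsto (fun n : ℕ => ((n : ℝ))⁻¹) atTop (𝓝 0) := tendsto_inv_atTop_nhds_zero_nat
  -- The term with `4 ^ (n - 1)` is of lower order, by the bound `4 ^ n ≤ 2 n * centralBinom n`.
  have hsmall : Tendsto (fun n : ℕ => (4 : ℝ) ^ n / n.centralBinom * (n : ℝ)⁻¹ * (n : ℝ)⁻¹)
      atTop (𝓝 0) := by
    have hb : Tendsto (fun n : ℕ => 2 * (n : ℝ)⁻¹) atTop (𝓝 0) := by
      simpa using hi.const_mul 2
    refine squeeze_zero' (Eventually.of_forall fun n => by positivity) ?_ hb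
    filter_upwards [eventually_ge_atTop 1] with n hn
    have hcb : (0 : ℝ) < n.centralBinom := by exact_mod_cast n.centralBinom_pos
    have hn0 : (0 : ℝ) < n := by exact_mod_cast hn
    have h : (4 : ℝ) ^ n ≤ 2 * n * n.centralBinom := by
      exact_mod_cast Nat.four_pow_le_two_mul_self_mul_centralBinom n hn
    have h' : (4 : ℝ) ^ n / n.centralBinom ≤ 2 * n := (div_le_iff₀ hcb).2 h
    calc (4 : ℝ) ^ n / n.centralBinom * (n : ℝ)⁻¹ * (n : ℝ)⁻¹
        ≤ 2 * n * (n : ℝ)⁻¹ * (n : ℝ)⁻¹ := by gcongr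
      _ = 2 * (n : ℝ)⁻¹ := by field_simp
  have hW := Wallis.tendsto_W_nhds_pi_div_two
  -- With `y = 1 / n`, the quotient is polynomial in `y`, Wallis' product and the small term.
  have hlim : Tendsto (fun n : ℕ =>
      (4 / 15 + 73 / 60 * (n : ℝ)⁻¹ + 26 / 15 * (n : ℝ)⁻¹ ^ 2 + 8 / 15 * (n : ℝ)⁻¹ ^ 3
        - 1 / 2 * (n : ℝ)⁻¹ ^ 4 - 1 / 4 * (n : ℝ)⁻¹ ^ 5)
      - Wallis.W n * (2 + (n : ℝ)⁻¹) / 16 * ((1 + (n : ℝ)⁻¹) * (1 + 2 * (n : ℝ)⁻¹)) ^ 2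
      + (4 : ℝ) ^ n / n.centralBinom * (n : ℝ)⁻¹ * (n : ℝ)⁻¹ / 4 *
        ((1 + (n : ℝ)⁻¹) ^ 2 * (1 + 2 * (n : ℝ)⁻¹))) atTop
      (𝓝 ((4 / 15 + 73 / 60 * 0 + 26 / 15 * 0 ^ 2 + 8 / 15 * 0 ^ 3
        - 1 / 2 * 0 ^ 4 - 1 / 4 * 0 ^ 5)
      - π / 2 * (2 + 0) / 16 * ((1 + 0) * (1 + 2 * 0)) ^ 2
      + 0 / 4 * ((1 + 0) ^ 2 * (1 + 2 * 0)))) := by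
    have hone : Tendsto (fun n : ℕ => 1 + (n : ℝ)⁻¹) atTop (𝓝 (1 + 0)) := hi.const_add 1
    have htwo : Tendsto (fun n : ℕ => 1 + 2 * (n : ℝ)⁻¹) atTop (𝓝 (1 + 2 * 0)) :=
      (hi.const_mul 2).const_add 1
    refine Tendsto.add (Tendsto.sub ?_ ?_) ?_
    · have hp : Continuous fun y : ℝ => 4 / 15 + 73 / 60 * y + 26 / 15 * y ^ 2 + 8 / 15 * y ^ 3
          - 1 / 2 * y ^ 4 - 1 / 4 * y ^ 5 := by fun_prop
      exact (hp.tendsto 0).comp hi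
    · exact ((hW.mul (hi.const_add 2)).div_const 16).mul ((hone.mul htwo).pow 2)
    · exact (hsmall.div_const 4).mul ((hone.pow 2).mul htwo)
  have hval : (4 / 15 - π / 16 : ℝ) = ((4 / 15 + 73 / 60 * 0 + 26 / 15 * 0 ^ 2 + 8 / 15 * 0 ^ 3
        - 1 / 2 * 0 ^ 4 - 1 / 4 * 0 ^ 5)
      - π / 2 * (2 + 0) / 16 * ((1 + 0) * (1 + 2 * 0)) ^ 2
      + 0 / 4 * ((1 + 0) ^ 2 * (1 + 2 * 0))) := by ring
  rw [hval]
  refine hlim.congr' ?_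
  filter_upwards [eventually_ge_atTop 1] with n hn
  have hcb : (n.centralBinom : ℝ) = (n + 1) * catalan n := by
    exact_mod_cast (succ_mul_catalan_eq_centralBinom n).symm
  have hn0 : (n : ℝ) ≠ 0 := by positivity
  have hn1 : (n : ℝ) + 1 ≠ 0 := by positivity
  have hC : (catalan n : ℝ) ≠ 0 := by exact_mod_cast (catalan_pos n).ne'
  have h4 : (4 : ℝ) ^ n = 4 * 4 ^ (n - 1) := by rw [← pow_succ', Nat.sub_add_cancel hn]
  have h16 : (16 : ℝ) ^ (n - 1) =
      Wallis.W n * (2 * n + 1) * ((n + 1) * catalan n : ℝ) ^ 2 / 16 := by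
    rw [← hcb, wallis_mul_centralBinom_sq, eq_div_iff (by norm_num), ← pow_succ,
      Nat.sub_add_cancel hn]
  rw [avalancheVariance_closed_form hn, hcb, h4, h16]
  generalize (4 : ℝ) ^ (n - 1) = P
  generalize (catalan n : ℝ) = K at *
  generalize Wallis.W n = w
  generalize (n : ℝ) = x at *
  field_simp
  ring

end PlaneTree

theorem mainTheorem4 :
    (∀ n : ℕ, 1 ≤ n →
      PlaneTree.avalancheVariance n =
        4 / 15 * (n : ℝ) ^ 3 + 73 / 60 * (n : ℝ) ^ 2 + 26 / 15 * (n : ℝ) + 8 / 15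
          - 1 / (2 * (n : ℝ)) - 1 / (4 * (n : ℝ) ^ 2)
          - (16 : ℝ) ^ (n - 1) / ((n : ℝ) ^ 2 * ((n : ℝ) + 1) ^ 2 * (catalan n : ℝ) ^ 2)
              * ((n : ℝ) ^ 4 + 6 * (n : ℝ) ^ 3 + 13 * (n : ℝ) ^ 2 + 12 * (n : ℝ) + 4)
          + (4 : ℝ) ^ (n - 1) / ((n : ℝ) ^ 2 * ((n : ℝ) + 1) * (catalan n : ℝ))
              * ((n : ℝ) ^ 3 + 4 * (n : ℝ) ^ 2 + 5 * (n : ℝ) + 2)) ∧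
    Asymptotics.IsEquivalent Filter.atTop
      (fun n : ℕ => PlaneTree.avalancheVariance n)
      (fun n : ℕ => (4 / 15 - Real.pi / 16) * (n : ℝ) ^ 3) := by
  refine ⟨fun n hn => PlaneTree.avalancheVariance_closed_form hn, ?_⟩
  have hpi : 4 / 15 - Real.pi / 16 ≠ 0 := by
    have := Real.pi_lt_d2
    linarith
  refine (Asymptotics.isEquivalent_iff_tendsto_one ?_).2 ?_
  · filter_upwards [Filter.eventually_ge_atTop 1] with n hn
    have : (n : ℝ) ≠ 0 := by positivity
    positivity
  · have h := PlaneTree.tendsto_avalancheVariance_div_pow_three.div_const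
      (4 / 15 - Real.pi / 16)
    rw [div_self hpi] at h
    refine h.congr fun n => ?_
    rw [Pi.div_apply, div_div, mul_comm]
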